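/- Conventions. Digraphs are finite. A cut of a digraph with vertex set $V$ is a set $S$ with $\emptyset\subset S\subset V$ (both inclusions strict). A star is a nonempty set of arcs that all have the same source. An instance of Star Strong Connectivity (SSC) is a strongly connected digraph $G=(V,E)$ with a set $\mathcal C$ of stars such that $\bigcup_{F\in\mathcal C}F=E$; a solution is a set $R\subseteq\mathcal C$ such that $(V,\bigcup_{F\in R}F)$ is strongly connected, and the aim is to minimize $|R|$. For a cut $S$, let $\partial\mathcal C(S)$ be the set of all $F\in\mathcal C$ that contain an arc from $S$ to $V\setminus S$. The cut-based linear program for SSC and its dual are $$\min\sum_{F\in\mathcal C}x_F\quad\text{s.t.}\quad \sum_{F\in\partial\mathcal C(S)}x_F\ge 1\ \text{ for all cuts } S,\qquad x\ge 0,$$ $$\max\sum_{\emptyset\subset S\subset V}y_S\quad\text{s.t.}\quad \sum_{S:\,F\in\partial\mathcal C(S)}y_S\le 1\ \text{ for all } F\in\mathcal C,\qquad y\ge 0.$$ An instance of Minimum Strongly Connected Spanning Subgraph (MSCS) is a strongly connected digraph $G=(V,E)$; a solution is a set $T\subseteq E$ such that $(V,T)$ is strongly connected, and the aim is to minimize $|T|$.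 Its cut-based linear program and dual are those above with the arcs $e\in E$ in place of the stars $F\in\mathcal C$, where $e$ belongs to the boundary of $S$ if it goes from $S$ to $V\setminus S$. The integrality gap of such a program is the supremum, over all instances with at least two vertices, of the optimal value of the program restricted to integer $x$ divided by the optimal value of the linear program. Theorem. The integrality gap of the cut-based linear program for SSC is at most $1.6$, and so is the integrality gap of the cut-based linear program for MSCS. Moreover, the gap between integer primal and integer dual solutions is at most $1.6$: for every instance of SSC there are a solution $R\subseteq\mathcal C$, whose indicator vector is then feasible for the primal program, and an integer-valued feasible solution $y$ of the dual program with $$|R|\le 1.6\sum_{\emptyset\subset S\subset V}y_S,$$ and for every instance of MSCS there are likewise a solution $T\subseteq E$, whose indicator vector is feasible for the primal program, and an integer-valued feasible solution $y$ of the dual program with $|T|\le 1.6\sum_{\emptyset\subset S\subset V}y_S$. -/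

import Mathlib

open scoped ENNReal

/-- A digraph is strongly connected if every vertex reaches every vertex by a directed path. -/
def Digraph.StronglyConnected {V : Type*} (G : Digraph V) : Prop :=
  ∀ u v : V, Relation.ReflTransGen G.Adj u v

/-- The digraph `(V, A)` with vertex set `V` and arc set `A`. -/
def Digraph.ofArcs {V : Type*} (A : Set (V × V)) : Digraph V where
  Adj u v := (u, v) ∈ A

/-- The cuts of a finite vertex set: the sets `S` with `∅ ⊂ S ⊂ V`. -/
noncomputable def cuts (V : Type*) [Fintype V] : Finset (Finset V) :=
  open Classical in Finset.univ.filter fun S => S.Nonempty ∧ S ≠ Finset.univ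

/-- The data of a cut-based covering program: one variable for each element of `elements`, one
covering constraint for each cut `S`, whose sum runs over the elements that cross `S`. -/
structure CutProgram (V ι : Type*) where
  elements : Finset ι
  Crosses : ι → Finset V → Prop

namespace CutProgram

variable {V ι : Type*} [Fintype V] (P : CutProgram V ι)

/-- The elements crossing `S`. -/
noncomputable def boundary (S : Finset V) : Finset ι :=
  open Classical in P.elements.filter fun i => P.Crosses i S

/-- The cuts crossed by `i`. -/
noncomputable def crossedCuts (i : ι) : Finset (Finset V) :=
  open Classical in (cuts V).filter fun S => i ∈ P.boundary S

/-- Feasibility for the primal linear program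
`min ∑ x_i` subject to `∑_{i ∈ ∂S} x_i ≥ 1` for each cut `S`, and `x ≥ 0`. -/
def PrimalFeasible (x : ι → ℝ) : Prop :=
  (∀ S ∈ cuts V, 1 ≤ ∑ i ∈ P.boundary S, x i) ∧ ∀ i ∈ P.elements, 0 ≤ x i

/-- Feasibility for the dual linear program
`max ∑ y_S` subject to `∑_{S : i ∈ ∂S} y_S ≤ 1` for each element `i`, and `y ≥ 0`. -/
def DualFeasible (y : Finset V → ℝ) : Prop :=
  (∀ i ∈ P.elements, ∑ S ∈ P.crossedCuts i, y S ≤ 1) ∧ ∀ S ∈ cuts V, 0 ≤ y S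

def PrimalIntegral (x : ι → ℝ) : Prop := ∀ i ∈ P.elements, ∃ k : ℤ, x i = k

def primalValue (x : ι → ℝ) : ℝ := ∑ i ∈ P.elements, x i

/-- The optimal value of the linear program (it is nonnegative; `⊤` would mean infeasible). -/
noncomputable def lpOpt : ℝ≥0∞ :=
  ⨅ (x : ι → ℝ) (_ : P.PrimalFeasible x), ENNReal.ofReal (P.primalValue x)

/-- The optimal value of the integer program. -/
noncomputable def ilpOpt : ℝ≥0∞ :=
  ⨅ (x : ι → ℝ) (_ : P.PrimalFeasible x ∧ P.PrimalIntegral x), ENNReal.ofReal (P.primalValue x)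

end CutProgram

/-- `y` takes integer values on all cuts. -/
def DualIntegral {V : Type*} [Fintype V] (y : Finset V → ℝ) : Prop :=
  ∀ S ∈ cuts V, ∃ k : ℤ, y S = k

noncomputable def dualValue {V : Type*} [Fintype V] (y : Finset V → ℝ) : ℝ :=
  ∑ S ∈ cuts V, y S

/-- A star is a nonempty set of arcs that all have the same source. -/
def IsStar {V : Type*} (F : Finset (V × V)) : Prop :=
  F.Nonempty ∧ ∃ v : V, ∀ e ∈ F, e.1 = v

/-- An instance of Star Strong Connectivity: a strongly connected digraph and a set of stars whose
union is its arc set. -/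
structure SSCInstance (V : Type*) where
  G : Digraph V
  stronglyConnected : G.StronglyConnected
  stars : Finset (Finset (V × V))
  isStar : ∀ F ∈ stars, IsStar F
  cover : ∀ u v, G.Adj u v ↔ ∃ F ∈ stars, (u, v) ∈ F

namespace SSCInstance

variable {V : Type*} (I : SSCInstance V)

/-- `R` is a solution: a set of stars of the instance whose arcs form a strongly connected
digraph on all of `V`. -/
def IsSolution (R : Finset (Finset (V × V))) : Prop :=
  R ⊆ I.stars ∧ (Digraph.ofArcs {e : V × V | ∃ F ∈ R, e ∈ F}).StronglyConnected

/-- The cut-based program of Star Strong Connectivity: a star crosses `S` if its source is in `S`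
and at least one of its sinks is outside `S`. -/
def program : CutProgram V (Finset (V × V)) where
  elements := I.stars
  Crosses F S := ∃ e ∈ F, e.1 ∈ S ∧ e.2 ∉ S

end SSCInstance

/-- An instance of Minimum Strongly Connected Spanning Subgraph: a strongly connected digraph,
given by its finite arc set. -/
structure MSCSInstance (V : Type*) where
  arcs : Finset (V × V)
  stronglyConnected : (Digraph.ofArcs (arcs : Set (V × V))).StronglyConnected

namespace MSCSInstance

variable {V : Type*} (I : MSCSInstance V)

/-- `T` is a solution: a set of arcs forming a strongly connected spanning subgraph. -/
def IsSolution (T : Finset (V × V)) : Prop :=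
  T ⊆ I.arcs ∧ (Digraph.ofArcs (T : Set (V × V))).StronglyConnected

/-- The cut-based program of Minimum Strongly Connected Spanning Subgraph. -/
def program : CutProgram V (V × V) where
  elements := I.arcs
  Crosses e S := e.1 ∈ S ∧ e.2 ∉ S

end MSCSInstance

/-- The integrality gap of the cut-based linear program for Star Strong Connectivity: the supremum,
over all instances with at least two vertices, of the optimal integer value divided by the optimal
fractional value. (With one vertex there is no cut and both values are `0`. Every instance is
isomorphic to one on a vertex set `Fin n`.) -/
noncomputable def sscIntegralityGap : ℝ≥0∞ :=
  ⨆ (n : ℕ) (_ : 2 ≤ n) (I : SSCInstance (Fin n)), I.program.ilpOpt / I.program.lpOpt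

/-- The integrality gap of the cut-based linear program for Minimum Strongly Connected Spanning
Subgraph. -/
noncomputable def mscsIntegralityGap : ℝ≥0∞ :=
  ⨆ (n : ℕ) (_ : 2 ≤ n) (I : MSCSInstance (Fin n)), I.program.ilpOpt / I.program.lpOpt

/-! Both problems are about stars, an arc being a star with one sink. If no star crosses two cuts of
a family, the indicator of the family is an integral dual solution. For |V| ≥ 2 the singletons form
such a family, because a star crosses {v} only if its source is v. Hence the largest size D of such
a family is at least |V|, and it suffices to find connecting stars R and an independent family 𝒮
with 5|R| ≤ 6(|V| - 1) + 2|𝒮|, which is at most 8D.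

This bound comes from repeated contraction (`exists_connects_independent`). Contracting U pays 6 for
each of the |U| - 1 vertices lost, and 2 for each new cut. The new cuts are crossed only by stars
inside U, which become loops, so they never conflict with cuts found later. The sets U are perfect:
at most |U| stars connect them. Since 5k ≤ 6(k - 1) + 2 for k ≥ 4 and 5k ≤ 6(k - 1) + 4 for k ≥ 2, a
perfect set needs one such cut if it has four vertices, and otherwise two. Perfect sets come from
`exists_perfect`: stars on a cycle are completed by one star at every other vertex leading towards
it, and whatever the cycle then reaches is strongly connected.

The existence of U is `reducible`. Take a vertex v with a single out-neighbour or, if there is none,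
a suitable end v of a longest path. A perfect set containing v and its out-neighbours has the cut
{v}. If no such set has four vertices, then every star that would produce a fourth vertex is
excluded, and this forces a second cut whose crossing stars all stay within two or three vertices
around v. -/

/-- Stars given abstractly: each has a source and a set of sinks. -/
structure StarSystem (V ι : Type*) where
  src : ι → V
  tgt : ι → Set V

namespace StarSystem

open Relation

universe u w

variable {V : Type u} {ι : Type w} (H : StarSystem V ι)

/-- The arcs of the stars in `T`. -/
def Arc (T : Set ι) (x y : V) : Prop := ∃ i ∈ T, H.src i = x ∧ y ∈ H.tgt i

/-- The stars in `T` form a strongly connected digraph. -/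
def Connects (T : Set ι) : Prop := ∀ x y, ReflTransGen (H.Arc T) x y

def Crosses (i : ι) (S : Set V) : Prop := H.src i ∈ S ∧ ∃ t ∈ H.tgt i, t ∉ S

/-- Adjacency through some star, loops excluded. -/
def Adj (x y : V) : Prop := x ≠ y ∧ H.Arc Set.univ x y

/-- Adjacency in the digraph with the vertices in `X` deleted. -/
def AdjOff (X : Set V) (x y : V) : Prop := H.Adj x y ∧ x ∉ X ∧ y ∉ X

/-- A family of cuts such that no star crosses two of them. -/
def Independent (𝒮 : Set (Set V)) : Prop :=
  (∀ S ∈ 𝒮, S.Nonempty ∧ Sᶜ.Nonempty) ∧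
    ∀ i, ∀ S ∈ 𝒮, ∀ T ∈ 𝒮, H.Crosses i S → H.Crosses i T → S = T

/-- `U` is strongly connected by at most `|U|` stars. -/
def Perfect (U : Set V) : Prop :=
  ∃ Q : Set ι, Q.ncard ≤ U.ncard ∧ ∀ x ∈ U, ∀ y ∈ U, ReflTransGen (H.Arc Q) x y

/-- There is a vertex set `U` whose contraction is paid for by cuts that are crossed only by stars
inside `U`. -/
def Reducible : Prop :=
  ∃ (U : Set V) (Q : Set ι) (𝓔 : Set (Set V)), 2 ≤ U.ncard ∧
    (∀ x ∈ U, ∀ y ∈ U, ReflTransGen (H.Arc Q) x y) ∧ H.Independent 𝓔 ∧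
    (∀ S ∈ 𝓔, ∀ i, H.Crosses i S → H.src i ∈ U ∧ H.tgt i ⊆ U) ∧
    5 * Q.ncard ≤ 6 * (U.ncard - 1) + 2 * 𝓔.ncard

/-- The image of a star system under a map of the vertices. -/
def map {W : Type*} (π : V → W) : StarSystem W ι where
  src i := π (H.src i)
  tgt i := π '' H.tgt i

variable {H}

theorem Arc.mono {T T' : Set ι} (h : T ⊆ T') {x y : V} : H.Arc T x y → H.Arc T' x y :=
  fun ⟨i, hi, h1⟩ => ⟨i, h hi, h1⟩

theorem reach_mono {T T' : Set ι} (h : T ⊆ T') {x y : V} (hxy : ReflTransGen (H.Arc T) x y) :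
    ReflTransGen (H.Arc T') x y :=
  ReflTransGen.mono (fun _ _ => Arc.mono h) _ _ hxy

theorem reach_of_mem {T : Set ι} {i : ι} (hi : i ∈ T) {x y : V} (hx : H.src i = x)
    (hy : y ∈ H.tgt i) : ReflTransGen (H.Arc T) x y := .single ⟨i, hi, hx, hy⟩

theorem reach_adj (hH : H.Connects Set.univ) (x y : V) : ReflTransGen H.Adj x y := by
  induction hH x y with
  | refl => exact .refl
  | @tail b c _ h ih =>
    by_cases hbc : b = c
    · exact hbc ▸ ih
    · exact ih.tail ⟨hbc, h⟩

theorem AdjOff.arc {X : Set V} {x y : V} (h : H.AdjOff X x y) : H.Arc Set.univ x y := h.1.2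

theorem reach_adjOff_notMem {X : Set V} {x y : V} (h : ReflTransGen (H.AdjOff X) x y)
    (hx : x ∉ X) : y ∉ X := by
  cases h with
  | refl => exact hx
  | tail _ h => exact h.2.2

theorem exists_crosses {T : Set ι} (hT : H.Connects T) {S : Set V} (hS : S.Nonempty)
    (hS' : Sᶜ.Nonempty) : ∃ i ∈ T, H.Crosses i S := by
  obtain ⟨x, hx⟩ := hS
  obtain ⟨y, hy⟩ := hS'
  by_contra! hno
  refine hy ?_
  induction hT x y with
  | refl => exact hx
  | tail _ h ih =>
    obtain ⟨i, hi, rfl, h2⟩ := h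
    by_contra hc
    exact hno i hi ⟨not_not.1 fun hb => ih hb |> hb, _, h2, hc⟩

/-! ### Contraction and the accounting of stars against cuts -/

section Contraction

variable {W : Type*} {π : V → W}

theorem crosses_map {i : ι} {S : Set W} : (H.map π).Crosses i S ↔ H.Crosses i (π ⁻¹' S) := by
  simp [Crosses, map]

theorem Connects.map (hπ : π.Surjective) {T : Set ι} (hT : H.Connects T) :
    (H.map π).Connects T := by
  intro x y
  obtain ⟨x, rfl⟩ := hπ x
  obtain ⟨y, rfl⟩ := hπ y
  refine ReflTransGen.lift π ?_ _ _ (hT x y)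
  rintro a b ⟨i, hi, rfl, hb⟩
  exact ⟨i, hi, rfl, b, hb, rfl⟩

/-- A path in the image lifts to pieces, and `Q` joins the end of each piece to the start of the
next inside a fibre. -/
theorem Connects.of_map {Q R : Set ι}
    (hQ : ∀ x y, π x = π y → ReflTransGen (H.Arc Q) x y) (hR : (H.map π).Connects R) :
    H.Connects (R ∪ Q) := by
  have key : ∀ a b, ReflTransGen ((H.map π).Arc R) a b → ∀ x y, π x = a → π y = b →
      ReflTransGen (H.Arc (R ∪ Q)) x y := by
    intro a b hab
    induction hab with
    | refl =>
      rintro x y hx hy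
      exact reach_mono Set.subset_union_right (hQ x y (hx.trans hy.symm))
    | tail _ h ih =>
      obtain ⟨i, hi, h1, t, ht, rfl⟩ := h
      intro x y hx hy
      have h2 := ih x (H.src i) hx h1
      have h3 := hQ t y hy.symm
      exact (h2.tail ⟨i, .inl hi, rfl, ht⟩).trans (reach_mono Set.subset_union_right h3)
  exact fun x y => key _ _ (hR (π x) (π y)) x y rfl rfl

end Contraction

/-- A star inside `U` has its source and sinks in one fibre, so it crosses no preimage. Disjointness
follows because strong connectivity makes every cut crossed by some star. -/
theorem Independent.union_preimage {W : Type*} {π : V → W} (hπ : π.Surjective)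
    (hH : H.Connects Set.univ) {U : Set V} (hU : ∀ x ∈ U, ∀ y ∈ U, π x = π y)
    {𝓔 : Set (Set V)} (h𝓔 : H.Independent 𝓔)
    (hin : ∀ S ∈ 𝓔, ∀ i, H.Crosses i S → H.src i ∈ U ∧ H.tgt i ⊆ U)
    {𝒮 : Set (Set W)} (h𝒮 : (H.map π).Independent 𝒮) :
    H.Independent ((π ⁻¹' ·) '' 𝒮 ∪ 𝓔) ∧ Disjoint ((π ⁻¹' ·) '' 𝒮) 𝓔 := by
  have hno : ∀ i, ∀ S ∈ 𝓔, ∀ T : Set W, H.Crosses i S → ¬ H.Crosses i (π ⁻¹' T) := by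
    rintro i S hS T h1 ⟨h2, t, ht, h3⟩
    obtain ⟨h4, h5⟩ := hin S hS i h1
    refine h3 ?_
    rw [Set.mem_preimage, ← hU _ h4 _ (h5 ht)]
    exact h2
  refine ⟨⟨?_, ?_⟩, ?_⟩
  · rintro S (⟨S, hS, rfl⟩ | hS)
    · obtain ⟨⟨x, hx⟩, ⟨y, hy⟩⟩ := h𝒮.1 S hS
      obtain ⟨x, rfl⟩ := hπ x
      obtain ⟨y, rfl⟩ := hπ y
      exact ⟨⟨x, hx⟩, ⟨y, hy⟩⟩
    · exact h𝓔.1 S hS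
  · rintro i S (⟨S, hS, rfl⟩ | hS) T (⟨T, hT, rfl⟩ | hT) h1 h2
    · rw [h𝒮.2 i S hS T hT (crosses_map.2 h1) (crosses_map.2 h2)]
    · exact (hno i T hT S h2 h1).elim
    · exact (hno i S hS T h1 h2).elim
    · exact h𝓔.2 i S hS T hT h1 h2
  · rw [Set.disjoint_left]
    rintro _ ⟨S, -, rfl⟩ hS
    obtain ⟨i, -, hi⟩ := exists_crosses hH (h𝓔.1 _ hS).1 (h𝓔.1 _ hS).2
    exact hno i _ hS S hi hi

/-- Contraction of `U` to the single vertex `none`. -/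
noncomputable def collapse (U : Set V) (x : V) : Option ↥Uᶜ :=
  open Classical in if h : x ∈ U then none else some ⟨x, h⟩

theorem collapse_surjective {U : Set V} (hU : U.Nonempty) : (collapse U).Surjective := by
  rintro (_ | ⟨x, hx⟩)
  · obtain ⟨x, hx⟩ := hU
    exact ⟨x, by simp [collapse, hx]⟩
  · have hx' : x ∉ U := hx
    exact ⟨x, by simp [collapse, hx']⟩

theorem collapse_eq {U : Set V} {x y : V} (h : collapse U x = collapse U y) :
    x = y ∨ x ∈ U ∧ y ∈ U := by
  by_cases hx : x ∈ U <;> by_cases hy : y ∈ U <;> simp_all [collapse]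

/-- Contraction leaves |V| - |U| + 1 vertices, so the terms 6(|V| - |U|) and 6(|U| - 1) add up to
6(|V| - 1). -/
theorem exists_connects_independent (hred : ∀ {V : Type u} [Finite V] (H : StarSystem V ι),
      H.Connects Set.univ → 2 ≤ Nat.card V → H.Reducible) [Finite ι] (n : ℕ) :
    ∀ {V : Type u} [Finite V] (H : StarSystem V ι), H.Connects Set.univ → Nat.card V = n →
      ∃ (R : Set ι) (𝒮 : Set (Set V)), H.Connects R ∧ H.Independent 𝒮 ∧
        5 * R.ncard ≤ 6 * (Nat.card V - 1) + 2 * 𝒮.ncard := by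
  induction n using Nat.strong_induction_on with
  | _ n ih =>
  intro V _ H hH hn
  rcases lt_or_ge (Nat.card V) 2 with h2 | h2
  · have : Subsingleton V := by
      rw [← Finite.card_le_one_iff_subsingleton]; omega
    refine ⟨∅, ∅, fun x y => Subsingleton.elim x y ▸ .refl, ⟨by simp, by simp⟩, by simp⟩
  obtain ⟨U, Q, 𝓔, hU, hQ, h𝓔, hin, hcard⟩ := hred H hH h2
  have hne : U.Nonempty := Set.nonempty_of_ncard_ne_zero (by omega)
  have hsurj := collapse_surjective hne
  have hW : Nat.card (Option ↥Uᶜ) + U.ncard = Nat.card V + 1 := by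
    rw [Finite.card_option, Nat.card_coe_set_eq]
    have := Set.ncard_add_ncard_compl U
    omega
  obtain ⟨R, 𝒮, hR, h𝒮, hc⟩ := ih (Nat.card (Option ↥Uᶜ)) (by omega) (H.map (collapse U))
    (hH.map hsurj) rfl
  have hUU : ∀ x ∈ U, ∀ y ∈ U, collapse U x = collapse U y := by
    intro x hx y hy
    simp [collapse, hx, hy]
  obtain ⟨h1, h3⟩ := Independent.union_preimage hsurj hH hUU h𝓔 hin h𝒮
  refine ⟨R ∪ Q, _, Connects.of_map ?_ hR, h1, ?_⟩
  · intro x y hxy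
    rcases collapse_eq hxy with rfl | ⟨hx, hy⟩
    · exact .refl
    · exact hQ x hx y hy
  · have h4 := Set.ncard_union_le R Q
    have h5 : 0 < Nat.card (Option ↥Uᶜ) := Nat.card_pos
    rw [Set.ncard_union_eq h3 (Set.toFinite _) (Set.toFinite _),
      Set.ncard_image_of_injective _ (Set.preimage_injective.2 hsurj)]
    omega

/-! ### Completing a choice of stars to a perfect set -/

/-- A partial choice `T` of one star per vertex extends along paths that lead to its sources. -/
theorem exists_extension_one {T T₁ : Set ι} (hT₁ : T ⊆ T₁) (hinj : T₁.InjOn H.src)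
    {r : V → V → Prop} (hr : ∀ x y, r x y → H.Arc Set.univ x y)
    (hgood : ∀ j ∈ T₁, ∃ i ∈ T, ReflTransGen r (H.src j) (H.src i) ∧
      ReflTransGen (H.Arc T₁) (H.src j) (H.src i))
    {b : V} {i : ι} (hi : i ∈ T) (hb : ReflTransGen r b (H.src i)) :
    ∃ T₂, T₁ ⊆ T₂ ∧ T₂.InjOn H.src ∧
      (∀ j ∈ T₂, ∃ i ∈ T, ReflTransGen r (H.src j) (H.src i) ∧
        ReflTransGen (H.Arc T₂) (H.src j) (H.src i)) ∧ b ∈ H.src '' T₂ := by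
  induction hb using ReflTransGen.head_induction_on with
  | refl => exact ⟨T₁, subset_rfl, hinj, hgood, i, hT₁ hi, rfl⟩
  | @head b c hbc hc ih =>
    obtain ⟨T₂, h12, hinj₂, hgood₂, j, hj, hjc⟩ := ih
    -- If `b` already has a star, that star leads to `T`. Otherwise the star of the arc from `b` to
    -- `c` is added, and `c` has one already.
    by_cases hmem : b ∈ H.src '' T₂
    · exact ⟨T₂, h12, hinj₂, hgood₂, hmem⟩
    obtain ⟨k, -, hk, hkc⟩ := hr b c hbc
    have hsub : T₂ ⊆ insert k T₂ := Set.subset_insert _ _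
    refine ⟨insert k T₂, h12.trans hsub, ?_, ?_, k, Set.mem_insert _ _, hk⟩
    · refine (Set.injOn_insert fun hkT => hmem ⟨k, hkT, hk⟩).2 ⟨hinj₂, hk ▸ hmem⟩
    · rintro l (rfl | hl)
      · obtain ⟨i', hi', h1, h2⟩ := hgood₂ j hj
        rw [hjc] at h1 h2
        rw [hk]
        exact ⟨i', hi', h1.head hbc,
          (reach_mono hsub h2).head ⟨l, Set.mem_insert _ _, hk, hkc⟩⟩
      · obtain ⟨i', hi', h1, h2⟩ := hgood₂ l hl
        exact ⟨i', hi', h1, reach_mono hsub h2⟩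

/-- The relation `r` is tracked beside the new arcs to tell which source of `T` is reached: for `r =
H.AdjOff X`, a path starting outside `X` ends at a source outside `X`. -/
theorem exists_extension [Finite V] {T : Set ι} (hinj : T.InjOn H.src)
    {r : V → V → Prop} (hr : ∀ x y, r x y → H.Arc Set.univ x y) (B : Set V)
    (hB : ∀ b ∈ B, ∃ i ∈ T, ReflTransGen r b (H.src i)) :
    ∃ T', T ⊆ T' ∧ T'.InjOn H.src ∧
      (∀ j ∈ T', ∃ i ∈ T, ReflTransGen r (H.src j) (H.src i) ∧
        ReflTransGen (H.Arc T') (H.src j) (H.src i)) ∧ B ⊆ H.src '' T' := by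
  induction B, B.toFinite using Set.Finite.induction_on with
  | empty => exact ⟨T, subset_rfl, hinj, fun j hj => ⟨j, hj, .refl, .refl⟩, Set.empty_subset _⟩
  | @insert b B _ _ ih =>
    obtain ⟨T₁, h1, hinj₁, hgood, hB₁⟩ := ih fun x hx => hB x (Set.mem_insert_of_mem _ hx)
    obtain ⟨i, hi, hbi⟩ := hB b (Set.mem_insert _ _)
    obtain ⟨T₂, h12, hinj₂, hgood₂, hb⟩ := exists_extension_one h1 hinj₁ hr hgood hi hbi
    exact ⟨T₂, h1.trans h12, hinj₂, hgood₂,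
      Set.insert_subset hb (hB₁.trans (Set.image_mono h12))⟩

/-- Extension along one path. -/
theorem exists_extension_path [Finite V] {T : Set ι} (hinj : T.InjOn H.src)
    {r : V → V → Prop} (hr : ∀ x y, r x y → H.Arc Set.univ x y) {b : V} {i : ι} (hi : i ∈ T)
    (hb : ReflTransGen r b (H.src i)) :
    ∃ T', T ⊆ T' ∧ T'.InjOn H.src ∧
      (∀ j ∈ T', ∃ i ∈ T, ReflTransGen (H.Arc T') (H.src j) (H.src i)) ∧
      ∃ i ∈ T, ReflTransGen r b (H.src i) ∧ ReflTransGen (H.Arc T') b (H.src i) := by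
  obtain ⟨T', h1, h2, h3, h4⟩ := exists_extension hinj hr {b} (by simpa using ⟨i, hi, hb⟩)
  refine ⟨T', h1, h2, fun j hj => ?_, ?_⟩
  · obtain ⟨i, hi, -, h⟩ := h3 j hj
    exact ⟨i, hi, h⟩
  · obtain ⟨j, hj, rfl⟩ := h4 rfl
    exact h3 j hj

/-- Stars with distinct sources that all reach `a` extend to a perfect set. -/
theorem exists_perfect [Finite V] [Finite ι] (hH : H.Connects Set.univ) {T : Set ι}
    (hinj : T.InjOn H.src) (a : V) (hne : T.Nonempty)
    (hroot : ∀ i ∈ T, ReflTransGen (H.Arc T) (H.src i) a) :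
    ∃ U, H.Perfect U ∧ ∀ x, ReflTransGen (H.Arc T) a x → x ∈ U := by
  obtain ⟨i₀, hi₀⟩ := hne
  -- Now every vertex has exactly one star, and every vertex reaches `a`.
  obtain ⟨T', hTT', hinj', hgood, huniv⟩ := exists_extension hinj (fun _ _ h => h) Set.univ
    fun b _ => ⟨i₀, hi₀, hH _ _⟩
  have hback : ∀ x, ReflTransGen (H.Arc T') x a := by
    intro x
    obtain ⟨j, hj, rfl⟩ := huniv (Set.mem_univ x)
    obtain ⟨i, hi, -, h⟩ := hgood j hj
    exact h.trans (reach_mono hTT' (hroot i hi))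
  -- What `a` reaches is strongly connected, since everything leads back to `a`. Only stars with
  -- source in this set are needed, one for each vertex.
  refine ⟨{x | ReflTransGen (H.Arc T') a x},
    ⟨{i ∈ T' | ReflTransGen (H.Arc T') a (H.src i)}, ?_, ?_⟩, fun x hx => reach_mono hTT' hx⟩
  · exact Set.ncard_le_ncard_of_injOn H.src (fun i hi => hi.2)
      (hinj'.mono fun i hi => hi.1) (Set.toFinite _)
  · intro x hx y hy
    induction (hback x).trans hy with
    | refl => exact .refl
    | @tail b c hb h ih =>
      obtain ⟨i, hi, rfl, hc⟩ := h
      exact (ih (hx.trans hb)).tail ⟨i, ⟨hi, hx.trans hb⟩, rfl, hc⟩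

/-! ### Perfect sets that give reducibility -/

theorem four_le_ncard [Finite V] {U : Set V} {a b c d : V} (ha : a ∈ U) (hb : b ∈ U) (hc : c ∈ U)
    (hd : d ∈ U) (hab : a ≠ b) (hac : a ≠ c) (had : a ≠ d) (hbc : b ≠ c) (hbd : b ≠ d)
    (hcd : c ≠ d) : 4 ≤ U.ncard := by
  classical
  have h : (({a, b, c, d} : Finset V) : Set V) ⊆ U := by
    simp [Set.insert_subset_iff, ha, hb, hc, hd]
  have h1 := Set.ncard_le_ncard h (Set.toFinite _)
  rw [Set.ncard_coe_finset] at h1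
  simpa [hab, hac, had, hbc, hbd, hcd] using h1

theorem two_le_ncard [Finite V] {U : Set V} {a b : V} (ha : a ∈ U) (hb : b ∈ U) (hab : a ≠ b) :
    2 ≤ U.ncard := (Set.one_lt_ncard (Set.toFinite _)).2 ⟨a, ha, b, hb, hab⟩

theorem mem_of_crosses_singleton {v : V} {U : Set V} (hv : v ∈ U)
    (hout : ∀ x, H.Adj v x → x ∈ U) {i : ι} (hi : H.Crosses i {v}) :
    H.src i ∈ U ∧ H.tgt i ⊆ U := by
  obtain ⟨h1, -⟩ := hi
  have h1 : H.src i = v := h1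
  refine ⟨h1 ▸ hv, fun t ht => ?_⟩
  by_cases h : v = t
  · exact h ▸ hv
  · exact hout t ⟨h, i, trivial, h1, ht⟩

/-- The single cut {v} suffices, as 5k ≤ 6(k - 1) + 2 for k ≥ 4. -/
theorem reducible_of_four_le [Finite V] {U : Set V} (hU : H.Perfect U) {v : V} (hv : v ∈ U)
    (hout : ∀ x, H.Adj v x → x ∈ U) (h4 : 4 ≤ U.ncard) : H.Reducible := by
  obtain ⟨Q, hQ, hconn⟩ := hU
  obtain ⟨y, -, hy⟩ := Set.exists_ne_of_one_lt_ncard (by omega : 1 < U.ncard) v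
  refine ⟨U, Q, {{v}}, by omega, hconn, ⟨?_, ?_⟩, ?_, ?_⟩
  · rintro S rfl
    exact ⟨⟨v, rfl⟩, ⟨y, hy⟩⟩
  · rintro i S rfl T rfl - -
    rfl
  · rintro S rfl i hi
    exact mem_of_crosses_singleton hv hout hi
  · rw [Set.ncard_singleton]
    omega

/-- The cuts `E` and {v} are independent because no star crossing `E` starts at `v`. Two cuts
suffice, as 5k ≤ 6(k - 1) + 4 for k ≥ 2. -/
theorem reducible_of_cut [Finite V] {U : Set V} (hU : H.Perfect U) {v : V} (hv : v ∈ U)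
    (hout : ∀ x, H.Adj v x → x ∈ U) (h2 : 2 ≤ U.ncard) {E : Set V} (hE : E.Nonempty)
    (hE' : Eᶜ.Nonempty) (hEv : E ≠ {v})
    (hcross : ∀ i, H.Crosses i E → H.src i ≠ v ∧ H.src i ∈ U ∧ H.tgt i ⊆ U) : H.Reducible := by
  obtain ⟨Q, hQ, hconn⟩ := hU
  obtain ⟨y, -, hy⟩ := Set.exists_ne_of_one_lt_ncard (by omega : 1 < U.ncard) v
  refine ⟨U, Q, {E, {v}}, h2, hconn, ⟨?_, ?_⟩, ?_, ?_⟩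
  · rintro S (rfl | rfl)
    · exact ⟨hE, hE'⟩
    · exact ⟨⟨v, rfl⟩, ⟨y, hy⟩⟩
  · rintro i S (rfl | rfl) T (rfl | rfl) h1 h2
    · rfl
    · exact ((hcross i h1).1 h2.1).elim
    · exact ((hcross i h2).1 h1.1).elim
    · rfl
  · rintro S (rfl | rfl) i hi
    · exact (hcross i hi).2
    · exact mem_of_crosses_singleton hv hout hi
  · rw [Set.ncard_pair hEv]
    omega

/-! ### A vertex with a single out-neighbour -/

theorem injOn_src_pair {i j : ι} (hij : H.src i ≠ H.src j) : ({i, j} : Set ι).InjOn H.src := by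
  rintro x (rfl | rfl) y (rfl | rfl) hxy <;> first | rfl | exact (hij hxy).elim |
    exact (hij hxy.symm).elim

theorem injOn_src_triple {i j k : ι} (hij : H.src i ≠ H.src j) (hik : H.src i ≠ H.src k)
    (hjk : H.src j ≠ H.src k) : ({i, j, k} : Set ι).InjOn H.src := by
  refine (Set.injOn_insert ?_).2 ⟨injOn_src_pair hjk, ?_⟩
  · rintro (rfl | rfl)
    · exact hij rfl
    · exact hik rfl
  · rintro ⟨l, rfl | rfl, h⟩
    · exact hij h.symm
    · exact hik h.symm

/-- A walk from `a` that passes through `v` must return to `a`, so that detour can be cut out. -/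
theorem reach_adjOff_pair {v a w : V} (huniq : ∀ x, H.Adj v x → x = a) {b x : V}
    (hb : b = a) (hbw : b ≠ w) (hbv : b ≠ v) (h : ReflTransGen (H.AdjOff {w}) b x) :
    x = v ∨ ReflTransGen (H.AdjOff {w, v}) b x := by
  subst hb
  induction h with
  | refl => exact .inr .refl
  | @tail y z hy hyz ih =>
    by_cases hz : z = v
    · exact .inl hz
    right
    rcases ih with rfl | ih
    · rw [huniq z hyz.1]
    · have hy' : y ∉ ({w, v} : Set V) := reach_adjOff_notMem ih (by simp [hbw, hbv])
      have hzw : z ≠ w := hyz.2.2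
      exact ih.tail ⟨hyz.1, hy', by simp [hz, hzw]⟩

/-- A further in-neighbour `w` of a vertex `v` with a unique out-neighbour `a`. -/
theorem reducible_of_unique_out_of_adj [Finite V] [Finite ι] (hH : H.Connects Set.univ) {v a w : V}
    (hva : H.Adj v a) (huniq : ∀ x, H.Adj v x → x = a) (hwv : H.Adj w v) (hwa : w ≠ a) :
    H.Reducible := by
  by_contra hred
  have big : ∀ U, H.Perfect U → v ∈ U → a ∈ U → w ∈ U → ∀ x ∈ U, x ≠ v → x ≠ a → x ≠ w →
      False := by
    intro U hU hv ha hw x hx h1 h2 h3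
    exact hred (reducible_of_four_le hU hv (fun y hy => huniq y hy ▸ ha)
      (four_le_ncard hv ha hw hx hva.1 hwv.1.symm h1.symm hwa.symm h2.symm h3.symm))
  obtain ⟨-, iv, -, hiv, hiva⟩ := id hva
  obtain ⟨-, iw, -, hiw, hiwv⟩ := id hwv
  have hav := hva.1.symm
  -- The second cut is what `a` reaches without `w`; a star leaving it must have `w` as a sink. A
  -- source other than `a` would lie on a cycle a ⇝ src i → w → v → a, and a further sink would be
  -- reached from the cycle a → w → v → a. Either gives a fourth vertex.
  have hE : ∀ i, H.Crosses i {x | ReflTransGen (H.AdjOff {w}) a x} → H.src i = a ∧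
      w ∈ H.tgt i ∧ H.tgt i ⊆ {a, v, w} := by
    rintro i ⟨hi, t, ht, htE⟩
    have hiw' : H.src i ≠ w := fun h =>
      reach_adjOff_notMem hi (by simpa using hwa.symm) (by simp [h])
    have htw : t = w := by
      by_contra htw
      refine htE (ReflTransGen.tail hi ⟨⟨?_, i, trivial, rfl, ht⟩, by simpa using hiw',
        by simpa using htw⟩)
      rintro rfl
      exact htE hi
    subst htw
    have hivn : H.src i ≠ v := fun h => hwa (huniq t ⟨hwv.1.symm, i, trivial, h, ht⟩)
    have hia : H.src i = a := by
      by_contra hia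
      have hreach := (reach_adjOff_pair huniq rfl hwa.symm hav hi).resolve_left hivn
      -- The path avoids the sources of `iv` and `iw`, so it can only end at the source of `i`.
      obtain ⟨T, h0, hinj, hroot, j, hj, hj1, hj2⟩ := exists_extension_path (H := H)
        (T := {i, iv, iw}) (r := H.AdjOff {t, v})
        (injOn_src_triple (by rwa [hiv]) (by rwa [hiw]) (by rw [hiv, hiw]; exact hwv.1.symm))
        (fun _ _ h => h.arc) (Set.mem_insert _ _) hreach
      have hjn := reach_adjOff_notMem hj1 (by simp [hwa.symm, hav])
      have hai : ReflTransGen (H.Arc T) a (H.src i) := by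
        rcases hj with rfl | rfl | rfl
        · exact hj2
        · simp [hiv] at hjn
        · simp [hiw] at hjn
      have e1 : ReflTransGen (H.Arc T) (H.src i) t := reach_of_mem (h0 (by simp)) rfl ht
      have e2 : ReflTransGen (H.Arc T) t v := reach_of_mem (h0 (by simp)) hiw hiwv
      have e3 : ReflTransGen (H.Arc T) v a := reach_of_mem (h0 (by simp)) hiv hiva
      obtain ⟨U, hU, hUT⟩ := exists_perfect hH hinj a ⟨i, h0 (by simp)⟩ (by
        intro k hk
        obtain ⟨l, hl, hkl⟩ := hroot k hk
        refine hkl.trans ?_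
        rcases hl with rfl | rfl | rfl
        · exact e1.trans (e2.trans e3)
        · rwa [hiv]
        · rw [hiw]; exact e2.trans e3)
      exact big U hU (hUT v (hai.trans (e1.trans e2))) (hUT a .refl) (hUT t (hai.trans e1)) _
        (hUT _ hai) hivn hia hiw'
    refine ⟨hia, ht, fun s hs => ?_⟩
    by_contra hsn
    simp only [Set.mem_insert_iff, Set.mem_singleton_iff, not_or] at hsn
    have e1 : ReflTransGen (H.Arc {i, iv, iw}) a t := reach_of_mem (by simp) hia ht
    have e2 : ReflTransGen (H.Arc {i, iv, iw}) t v := reach_of_mem (by simp) hiw hiwv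
    have e3 : ReflTransGen (H.Arc {i, iv, iw}) v a := reach_of_mem (by simp) hiv hiva
    obtain ⟨U, hU, hUT⟩ := exists_perfect hH (T := {i, iv, iw})
      (injOn_src_triple (by rwa [hiv]) (by rwa [hiw]) (by rw [hiv, hiw]; exact hwv.1.symm)) a
      ⟨i, by simp⟩ (by
        rintro k (rfl | rfl | rfl)
        · rw [hia]
        · rwa [hiv]
        · rw [hiw]; exact e2.trans e3)
    exact big U hU (hUT v (e1.trans e2)) (hUT a .refl) (hUT t e1) s
      (hUT s (reach_of_mem (by simp) hia hs)) hsn.2.1 hsn.1 hsn.2.2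
  have hwE : w ∉ {x | ReflTransGen (H.AdjOff {w}) a x} := fun h =>
    reach_adjOff_notMem h (by simpa using hwa.symm) rfl
  obtain ⟨i, -, hi⟩ := exists_crosses (S := {x | ReflTransGen (H.AdjOff {w}) a x}) hH
    ⟨a, .refl⟩ ⟨w, hwE⟩
  obtain ⟨hia, hiw', -⟩ := hE i hi
  have e1 : ReflTransGen (H.Arc {i, iv, iw}) a w := reach_of_mem (by simp) hia hiw'
  have e2 : ReflTransGen (H.Arc {i, iv, iw}) w v := reach_of_mem (by simp) hiw hiwv
  have e3 : ReflTransGen (H.Arc {i, iv, iw}) v a := reach_of_mem (by simp) hiv hiva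
  obtain ⟨U, hU, hUT⟩ := exists_perfect hH (T := {i, iv, iw})
    (injOn_src_triple (by rwa [hia, hiv]) (by rw [hia, hiw]; exact hwa.symm)
      (by rw [hiv, hiw]; exact hwv.1.symm)) a
    ⟨i, by simp⟩ (by
      rintro k (rfl | rfl | rfl)
      · rw [hia]
      · rwa [hiv]
      · rw [hiw]; exact e2.trans e3)
  have haU := hUT a .refl
  have hwU := hUT w e1
  have hvU := hUT v (e1.trans e2)
  refine hred (reducible_of_cut hU hvU (fun y hy => huniq y hy ▸ haU) (two_le_ncard hvU haU hva.1)
    (E := {x | ReflTransGen (H.AdjOff {w}) a x}) ⟨a, .refl⟩ ⟨w, hwE⟩ ?_ ?_)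
  · intro h
    exact hav (h ▸ (ReflTransGen.refl : ReflTransGen (H.AdjOff {w}) a a) :
      a ∈ ({v} : Set V))
  · intro j hj
    obtain ⟨h1, -, h2⟩ := hE j hj
    refine ⟨h1 ▸ hav, h1 ▸ haU, h2.trans ?_⟩
    rintro x (rfl | rfl | rfl) <;> assumption

/-- A vertex `v` whose only out-neighbour and only in-neighbour is `a`, and a star of `a` that
contains `v` and a further vertex. -/
theorem reducible_of_unique_out_of_star [Finite V] [Finite ι] (hH : H.Connects Set.univ)
    {v a x : V} (hva : H.Adj v a) (huniq : ∀ y, H.Adj v y → y = a) (hin : ∀ y, H.Adj y v → y = a)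
    {i : ι} (hia : H.src i = a) (hiv : v ∈ H.tgt i) (hix : x ∈ H.tgt i) (hxv : x ≠ v)
    (hxa : x ≠ a) : H.Reducible := by
  by_contra hred
  have big : ∀ U, H.Perfect U → v ∈ U → a ∈ U → x ∈ U → ∀ y ∈ U, y ≠ v → y ≠ a → y ≠ x →
      False := by
    intro U hU hv ha hx y hy h1 h2 h3
    exact hred (reducible_of_four_le hU hv (fun y hy => huniq y hy ▸ ha)
      (four_le_ncard hv ha hx hy hva.1 hxv.symm h1.symm hxa.symm h2.symm h3.symm))
  obtain ⟨-, k, -, hk, hka⟩ := id hva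
  have hav := hva.1.symm
  -- The second cut consists of the vertices that cannot reach `a` without passing `x`, so a star
  -- leaving it starts at `x`. Its sink `z` outside the cut is not `v`, whose only in-neighbour is
  -- `a`. If `z ≠ a`, the cycle a → x → z ⇝ a and the sink `v` of `i` give four vertices.
  have hE : ∀ j, H.Crosses j {y | ¬ ReflTransGen (H.AdjOff {x}) y a} → H.src j = x ∧
      a ∈ H.tgt j ∧ H.tgt j ⊆ {a, v, x} := by
    rintro j ⟨hj, z, hz, hza⟩
    have hza : ReflTransGen (H.AdjOff {x}) z a := not_not.1 hza
    have hzx : z ≠ x := by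
      rintro rfl
      rcases hza.cases_head with h | ⟨c, h, -⟩
      · exact hxa h
      · exact h.2.1 rfl
    have hjz : H.src j ≠ z := by
      rintro rfl
      exact hj hza
    have hjx : H.src j = x := by
      by_contra hjx
      exact hj (hza.head ⟨⟨hjz, j, trivial, rfl, hz⟩, hjx, hzx⟩)
    have hzv : z ≠ v := by
      rintro rfl
      exact hxa (hin x ⟨hxv, j, trivial, hjx, hz⟩)
    have hinj : ({i, j, k} : Set ι).InjOn H.src :=
      injOn_src_triple (by rw [hia, hjx]; exact hxa.symm) (by rwa [hia, hk]) (by rwa [hjx, hk])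
    have hza' : z = a := by
      by_contra hne
      obtain ⟨T, h0, hTinj, hroot, l, hl, hl1, hl2⟩ := exists_extension_path (H := H)
        (T := {i, j, k}) (r := H.AdjOff {x}) hinj (fun _ _ h => h.arc) (Set.mem_insert _ _)
        (hia ▸ hza)
      have e1 : ReflTransGen (H.Arc T) v a := reach_of_mem (h0 (by simp)) hk hka
      have e2 : ReflTransGen (H.Arc T) z a := by
        rcases hl with rfl | rfl | rfl
        · rwa [hia] at hl2
        · exact (reach_adjOff_notMem hl1 (by simpa using hzx) hjx).elim
        · rw [hk] at hl2; exact hl2.trans e1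
      have e3 : ReflTransGen (H.Arc T) x z := reach_of_mem (h0 (by simp)) hjx hz
      have e4 : ReflTransGen (H.Arc T) a x := reach_of_mem (h0 (by simp)) hia hix
      have e5 : ReflTransGen (H.Arc T) a v := reach_of_mem (h0 (by simp)) hia hiv
      obtain ⟨U, hU, hUT⟩ := exists_perfect hH hTinj a ⟨i, h0 (by simp)⟩ (by
        intro l hl
        obtain ⟨m, hm, hlm⟩ := hroot l hl
        refine hlm.trans ?_
        rcases hm with rfl | rfl | rfl
        · rw [hia]
        · rw [hjx]; exact e3.trans e2
        · rwa [hk])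
      exact big U hU (hUT v e5) (hUT a .refl) (hUT x e4) z (hUT z (e4.trans e3)) hzv hne hzx
    subst hza'
    refine ⟨hjx, hz, fun s hs => ?_⟩
    by_contra hsn
    simp only [Set.mem_insert_iff, Set.mem_singleton_iff, not_or] at hsn
    have e1 : ReflTransGen (H.Arc {i, j, k}) v z := reach_of_mem (by simp) hk hka
    have e3 : ReflTransGen (H.Arc {i, j, k}) x z := reach_of_mem (by simp) hjx hz
    have e4 : ReflTransGen (H.Arc {i, j, k}) z x := reach_of_mem (by simp) hia hix
    have e5 : ReflTransGen (H.Arc {i, j, k}) z v := reach_of_mem (by simp) hia hiv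
    obtain ⟨U, hU, hUT⟩ := exists_perfect hH hinj z ⟨i, by simp⟩ (by
      rintro l (rfl | rfl | rfl)
      · rw [hia]
      · rwa [hjx]
      · rwa [hk])
    exact big U hU (hUT v e5) (hUT z .refl) (hUT x e4) s
      (hUT s (e4.trans (reach_of_mem (by simp) hjx hs))) hsn.2.1 hsn.1 hsn.2.2
  have hxE : x ∈ {y | ¬ ReflTransGen (H.AdjOff {x}) y a} := by
    intro h
    rcases h.cases_head with h | ⟨c, h, -⟩
    · exact hxa h
    · exact h.2.1 rfl
  have haE : a ∈ {y | ¬ ReflTransGen (H.AdjOff {x}) y a}ᶜ := not_not.2 .refl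
  obtain ⟨j, -, hj⟩ := exists_crosses hH ⟨x, hxE⟩ ⟨a, haE⟩
  obtain ⟨hjx, hja, -⟩ := hE j hj
  have e1 : ReflTransGen (H.Arc {i, j, k}) v a := reach_of_mem (by simp) hk hka
  have e3 : ReflTransGen (H.Arc {i, j, k}) x a := reach_of_mem (by simp) hjx hja
  obtain ⟨U, hU, hUT⟩ := exists_perfect hH (T := {i, j, k})
    (injOn_src_triple (by rw [hia, hjx]; exact hxa.symm) (by rwa [hia, hk]) (by rwa [hjx, hk]))
    a ⟨i, by simp⟩ (by
      rintro l (rfl | rfl | rfl)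
      · rw [hia]
      · rwa [hjx]
      · rwa [hk])
  have haU := hUT a .refl
  have hxU := hUT x (reach_of_mem (by simp) hia hix)
  have hvU := hUT v (reach_of_mem (by simp) hia hiv)
  refine hred (reducible_of_cut hU hvU (fun y hy => huniq y hy ▸ haU) (two_le_ncard hvU haU hva.1)
    ⟨x, hxE⟩ ⟨a, haE⟩ ?_ ?_)
  · intro h
    rw [h] at hxE
    exact hxv hxE
  · intro l hl
    obtain ⟨h1, -, h2⟩ := hE l hl
    refine ⟨h1 ▸ hxv, h1 ▸ hxU, h2.trans ?_⟩
    rintro y (rfl | rfl | rfl) <;> assumption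

/-- In the case left over, only stars of `a` inside {a, v} enter `v`, so the complement of {v}
serves as the second cut. -/
theorem reducible_of_unique_out [Finite V] [Finite ι] (hH : H.Connects Set.univ) {v a : V}
    (hva : H.Adj v a) (huniq : ∀ x, H.Adj v x → x = a) : H.Reducible := by
  by_cases hin : ∀ w, H.Adj w v → w = a
  swap
  · push Not at hin
    obtain ⟨w, hwv, hwa⟩ := hin
    exact reducible_of_unique_out_of_adj hH hva huniq hwv hwa
  by_cases hst : ∀ i, H.src i = a → v ∈ H.tgt i → H.tgt i ⊆ {a, v}
  swap
  · push Not at hst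
    obtain ⟨i, hia, hiv, hsub⟩ := hst
    obtain ⟨x, hx, hxn⟩ := Set.not_subset.1 hsub
    simp only [Set.mem_insert_iff, Set.mem_singleton_iff, not_or] at hxn
    exact reducible_of_unique_out_of_star hH hva huniq hin hia hiv hx hxn.2 hxn.1
  have hav := hva.1.symm
  have hE : ∀ i, H.Crosses i {v}ᶜ → H.src i = a ∧ v ∈ H.tgt i := by
    rintro i ⟨h1, t, ht, h2⟩
    have ht' : t = v := by simpa using h2
    subst ht'
    exact ⟨hin _ ⟨h1, i, trivial, rfl, ht⟩, ht⟩
  obtain ⟨-, k, -, hk, hka⟩ := id hva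
  have haE : a ∈ ({v} : Set V)ᶜ := hav
  have hvE : v ∈ (({v} : Set V)ᶜ)ᶜ := by simp
  obtain ⟨i, -, hi⟩ := exists_crosses hH ⟨a, haE⟩ ⟨v, hvE⟩
  obtain ⟨hia, hiv⟩ := hE i hi
  obtain ⟨U, hU, hUT⟩ := exists_perfect hH (T := {i, k})
    (injOn_src_pair (by rwa [hia, hk])) a ⟨i, by simp⟩ (by
      rintro l (rfl | rfl)
      · rw [hia]
      · rw [hk]; exact reach_of_mem (by simp) hk hka)
  have haU := hUT a .refl
  have hvU := hUT v (reach_of_mem (by simp) hia hiv)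
  refine reducible_of_cut hU hvU (fun y hy => huniq y hy ▸ haU) (two_le_ncard hvU haU hva.1)
    ⟨a, haE⟩ ⟨v, hvE⟩ ?_ ?_
  · intro h
    rw [h] at haE
    exact hav haE
  · intro l hl
    obtain ⟨h1, h2⟩ := hE l hl
    refine ⟨h1 ▸ hav, h1 ▸ haU, (hst l h1 h2).trans ?_⟩
    rintro y (rfl | rfl) <;> assumption

/-! ### The end of a longest path -/

variable (H) in
/-- A path, listed from its last vertex to its first. -/
def IsPath (l : List V) : Prop := l.Nodup ∧ l.IsChain fun x y => H.Adj y x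

theorem exists_longest_path [Finite V] (v : V) : ∃ (v : V) (t : List V), H.IsPath (v :: t) ∧
    ∀ l, H.IsPath l → l.length ≤ (v :: t).length := by
  classical
  have := Fintype.ofFinite V
  have hle : ∀ l, H.IsPath l → l.length ≤ Fintype.card V := fun l hl => hl.1.length_le_card
  have h1 : H.IsPath [v] := ⟨by simp, by simp⟩
  obtain ⟨l, hl, hlen⟩ := Nat.findGreatest_spec (P := fun k => ∃ l, H.IsPath l ∧ l.length = k)
    (hle _ h1) ⟨[v], h1, rfl⟩
  have hmax : ∀ l', H.IsPath l' → l'.length ≤ l.length := fun l' hl' =>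
    hlen ▸ Nat.le_findGreatest (hle l' hl') ⟨l', hl', rfl⟩
  match l, hl, hmax with
  | [], _, hmax => simpa using hmax _ h1
  | v :: t, hl, hmax => exact ⟨v, t, hl, hmax⟩

theorem exists_last_split {α : Type*} {p : α → Prop} {t : List α} (h : ∃ x ∈ t, p x) :
    ∃ t₁ x t₂, t = t₁ ++ x :: t₂ ∧ p x ∧ ∀ y ∈ t₂, ¬ p y := by
  induction t with
  | nil => simp at h
  | cons c t ih =>
    by_cases ht : ∃ x ∈ t, p x
    · obtain ⟨t₁, x, t₂, rfl, h1, h2⟩ := ih ht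
      exact ⟨c :: t₁, x, t₂, rfl, h1, h2⟩
    · push Not at ht
      obtain ⟨x, hx, hpx⟩ := h
      rcases List.mem_cons.1 hx with rfl | hx
      · exact ⟨[], x, t, rfl, hpx, ht⟩
      · exact (ht x hx hpx).elim

/-- One star is taken for each arc of the path. The vertex `v` gets none, so a star closing a cycle
at `v` can be added with sources still distinct. -/
theorem exists_path_stars (t : List V) : ∀ v, H.IsPath (v :: t) →
    ∃ T : Set ι, T.InjOn H.src ∧ (∀ i ∈ T, H.src i ∈ t) ∧ ∀ x ∈ v :: t,
      ReflTransGen (H.Arc T) x v ∧ ReflTransGen (H.Arc T) ((v :: t).getLast (by simp)) x := by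
  induction t with
  | nil =>
    intro v _
    refine ⟨∅, by simp, by simp, fun x hx => ?_⟩
    obtain rfl : x = v := by simpa using hx
    exact ⟨.refl, .refl⟩
  | cons b t ih =>
    rintro v ⟨hn, hc⟩
    rw [List.isChain_cons_cons] at hc
    obtain ⟨T, hinj, hsrc, hT⟩ := ih b ⟨(List.nodup_cons.1 hn).2, hc.2⟩
    obtain ⟨-, k, -, hk, hkv⟩ := hc.1
    have hbt : b ∉ t := (List.nodup_cons.1 (List.nodup_cons.1 hn).2).1
    have hsub : T ⊆ insert k T := Set.subset_insert _ _
    have e : ReflTransGen (H.Arc (insert k T)) b v := reach_of_mem (Set.mem_insert _ _) hk hkv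
    have hnot : H.src k ∉ H.src '' T := by
      rintro ⟨i, hi, h⟩
      exact hbt (hk ▸ h ▸ hsrc i hi)
    refine ⟨insert k T, (Set.injOn_insert fun h => hnot ⟨k, h, rfl⟩).2 ⟨hinj, hnot⟩, ?_, ?_⟩
    · rintro i (rfl | hi)
      · simp [hk]
      · exact List.mem_cons_of_mem _ (hsrc i hi)
    · intro x hx
      rw [List.getLast_cons (by simp)]
      rcases List.mem_cons.1 hx with rfl | hx
      · exact ⟨.refl, (reach_mono hsub (hT b (by simp)).2).trans e⟩
      · exact ⟨(reach_mono hsub (hT x hx).1).trans e, reach_mono hsub (hT x hx).2⟩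

theorem reach_adjOff_of_path {X : Set V} (t : List V) : ∀ a, H.IsPath (a :: t) →
    (∀ x ∈ a :: t, x ∉ X) → ∀ x ∈ a :: t, ReflTransGen (H.AdjOff X) x a := by
  induction t with
  | nil =>
    intro a _ _ x hx
    obtain rfl : x = a := by simpa using hx
    exact .refl
  | cons b t ih =>
    rintro a ⟨hn, hc⟩ hX x hx
    rw [List.isChain_cons_cons] at hc
    rcases List.mem_cons.1 hx with rfl | hx
    · exact .refl
    · exact (ih b ⟨(List.nodup_cons.1 hn).2, hc.2⟩ (fun x hx => hX x (List.mem_cons_of_mem _ hx))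
        x hx).tail ⟨hc.1, hX b (by simp), hX a (by simp)⟩

theorem IsPath.adj_mem {v : V} {t : List V} (hp : H.IsPath (v :: t))
    (hmax : ∀ l, H.IsPath l → l.length ≤ (v :: t).length) {x : V} (hx : H.Adj v x) : x ∈ t := by
  by_contra hxt
  have := hmax (x :: v :: t) ⟨List.nodup_cons.2 ⟨by simp [hxt, hx.1.symm], hp.1⟩,
    List.isChain_cons_cons.2 ⟨hx, hp.2⟩⟩
  simp at this

/-- The last three vertices `a, b, v` of a longest path. -/
theorem exists_endpoint [Finite V] [Finite ι] (hH : H.Connects Set.univ) (h2 : 2 ≤ Nat.card V)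
    (hout : ∀ v a, H.Adj v a → ∃ x, H.Adj v x ∧ x ≠ a) (hred : ¬ H.Reducible) :
    ∃ v a b, H.Adj v a ∧ H.Adj v b ∧ H.Adj a b ∧ H.Adj b v ∧ (∀ x, H.Adj v x → x = a ∨ x = b) ∧
      ReflTransGen (H.AdjOff {v}) b a := by
  have : Nontrivial V := Finite.one_lt_card_iff_nontrivial.1 (by omega)
  obtain ⟨v₀, -⟩ := exists_pair_ne V
  obtain ⟨v, t, hp, hmax⟩ := exists_longest_path (H := H) v₀
  have hex : ∀ v, ∃ x, H.Adj v x := by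
    intro v
    obtain ⟨y, hy⟩ := exists_ne v
    rcases (reach_adj hH v y).cases_head with h | ⟨x, hx, -⟩
    · exact (hy h.symm).elim
    · exact ⟨x, hx⟩
  obtain ⟨x₀, hx₀⟩ := hex v
  -- The list runs backwards, so `x` is the out-neighbour of `v` farthest back on the path, and the
  -- cycle closed by the arc from `v` to `x` contains all out-neighbours of `v`.
  obtain ⟨t₁, x, t₂, rfl, hvx, hlast⟩ := exists_last_split ⟨x₀, hp.adj_mem hmax hx₀, hx₀⟩
  have hmem : ∀ y, H.Adj v y → y ∈ t₁ ∨ y = x := by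
    intro y hy
    have := hp.adj_mem hmax hy
    rw [List.mem_append, List.mem_cons] at this
    rcases this with h | h | h
    · exact .inl h
    · exact .inr h
    · exact (hlast y h hy).elim
  match t₁, hp, hmax, hmem with
  | [], hp, hmax, hmem =>
    obtain ⟨y, hy, hyx⟩ := hout v x hvx
    simpa [hyx] using hmem y hy
  -- Here that cycle has at least four vertices and lies in a perfect set.
  | b :: c :: t₁, hp, hmax, hmem =>
    refine (hred ?_).elim
    have hp' : H.IsPath (v :: ((b :: c :: t₁) ++ [x])) := by
      have hpre : v :: ((b :: c :: t₁) ++ [x]) <+: v :: (b :: c :: t₁ ++ x :: t₂) :=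
        ⟨t₂, by simp⟩
      exact ⟨hp.1.sublist hpre.sublist, hp.2.prefix hpre⟩
    obtain ⟨T, hinj, hsrc, hT⟩ := exists_path_stars (H := H) _ v hp'
    obtain ⟨-, k, -, hk, hkx⟩ := id hvx
    have hnot : H.src k ∉ H.src '' T := by
      rintro ⟨i, hi, h⟩
      exact (List.nodup_cons.1 hp'.1).1 (hk ▸ h ▸ hsrc i hi)
    have hsub : T ⊆ insert k T := Set.subset_insert _ _
    obtain ⟨U, hU, hUT⟩ := exists_perfect hH (T := insert k T)
      ((Set.injOn_insert fun h => hnot ⟨k, h, rfl⟩).2 ⟨hinj, hnot⟩) v ⟨k, Set.mem_insert _ _⟩ (by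
        rintro i (rfl | hi)
        · rw [hk]
        · exact reach_mono hsub (hT _ (List.mem_cons_of_mem _ (hsrc i hi))).1)
    have hall : ∀ y ∈ v :: ((b :: c :: t₁) ++ [x]), y ∈ U := by
      intro y hy
      have h1 := (hT y hy).2
      rw [show (v :: ((b :: c :: t₁) ++ [x])).getLast (by simp) = x by simp] at h1
      exact hUT y (ReflTransGen.head ⟨k, Set.mem_insert _ _, hk, hkx⟩ (reach_mono hsub h1))
    have hn := hp'.1
    simp only [List.cons_append, List.nodup_cons, List.mem_cons, List.mem_append, not_or] at hn
    refine reducible_of_four_le hU (hall v (by simp)) (fun y hy => hall y ?_)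
      (four_le_ncard (hall v (by simp)) (hall b (by simp)) (hall c (by simp)) (hall x (by simp))
        ?_ ?_ ?_ ?_ ?_ ?_)
    · rcases hmem y hy with h | h
      · exact List.mem_cons_of_mem _ (List.mem_append_left _ h)
      · simp [h]
    all_goals grind
  | [b], hp, hmax, hmem =>
    obtain ⟨hn, hc⟩ := id hp
    simp only [List.cons_append, List.nil_append, List.isChain_cons_cons] at hc
    obtain ⟨hbv, hxb, hc⟩ := hc
    simp only [List.cons_append, List.nil_append, List.nodup_cons] at hn
    obtain ⟨hvn, hbn, hxn⟩ := hn
    have hX : ∀ z ∈ x :: t₂, z ∉ ({v} : Set V) := by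
      rintro z hz rfl
      exact hvn (List.mem_cons_of_mem _ hz)
    have hpx : H.IsPath (x :: t₂) := ⟨List.nodup_cons.2 hxn, hc⟩
    have hpb : H.IsPath (b :: x :: t₂) :=
      ⟨List.nodup_cons.2 ⟨hbn, hpx.1⟩, List.isChain_cons_cons.2 ⟨hxb, hc⟩⟩
    have hreach := reach_adjOff_of_path t₂ x hpx hX
    have hbX : b ∉ ({v} : Set V) := hbv.1
    have hvb : H.Adj v b := by
      obtain ⟨y, hy, hyx⟩ := hout v x hvx
      have : y = b := by simpa [hyx] using hmem y hy
      exact this ▸ hy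
    refine ⟨v, x, b, hvx, hvb, hxb, hbv, fun y hy => ?_, ?_⟩
    · have := hmem y hy
      simpa [or_comm] using this
    -- If `y` is off the path, replacing `v` by `y` gives another longest path. So `y` has an
    -- out-neighbour other than `b` on it, from which the path leads to `x` without `v`.
    · obtain ⟨y, hby, hyv⟩ := hout b v hbv
      by_cases hy : y ∈ x :: t₂
      · exact (hreach y hy).head ⟨hby, hbX, hX y hy⟩
      · have hyp : H.IsPath (y :: b :: x :: t₂) :=
          ⟨List.nodup_cons.2 ⟨fun h => (List.mem_cons.1 h).elim hby.1.symm hy, hpb.1⟩,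
            List.isChain_cons_cons.2 ⟨hby, hpb.2⟩⟩
        have hmem' : ∀ z, H.Adj y z → z ∈ b :: x :: t₂ := fun z hz =>
          hyp.adj_mem (fun l hl => hmax l hl) hz
        obtain ⟨z, hyz, hzb⟩ : ∃ z, H.Adj y z ∧ z ≠ b := by
          obtain ⟨z, hz⟩ := hex y
          by_cases hzb : z = b
          · exact hzb ▸ hout y z hz
          · exact ⟨z, hz, hzb⟩
        have hz := (List.mem_cons.1 (hmem' z hyz)).resolve_left hzb
        exact ((hreach z hz).head ⟨hyz, hyv, hX z hz⟩).head ⟨hby, hbX, hyv⟩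

/-! ### Every system with at least two vertices is reducible -/

theorem reducible [Finite V] [Finite ι] (hH : H.Connects Set.univ) (h2 : 2 ≤ Nat.card V) :
    H.Reducible := by
  by_contra hred
  have hout : ∀ v a, H.Adj v a → ∃ x, H.Adj v x ∧ x ≠ a := by
    intro v a hva
    by_contra! h
    exact hred (reducible_of_unique_out hH hva h)
  obtain ⟨v, a, b, hva, hvb, hab, hbv, huniq, hba⟩ := exists_endpoint hH h2 hout hred
  have big : ∀ U, H.Perfect U → v ∈ U → a ∈ U → b ∈ U → U ⊆ {a, b, v} := by
    intro U hU hv ha hb y hy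
    by_contra hyn
    simp only [Set.mem_insert_iff, Set.mem_singleton_iff, not_or] at hyn
    refine hred (reducible_of_four_le hU hv (fun z hz => ?_)
      (four_le_ncard hv ha hb hy hva.1 hvb.1 (Ne.symm hyn.2.2) hab.1 (Ne.symm hyn.1)
        (Ne.symm hyn.2.1)))
    rcases huniq z hz with rfl | rfl <;> assumption
  obtain ⟨-, ka, -, hka, hkaa⟩ := id hva
  obtain ⟨-, kb, -, hkb, hkbb⟩ := id hvb
  obtain ⟨-, ab, -, habs, habt⟩ := id hab
  obtain ⟨-, bv, -, hbvs, hbvt⟩ := id hbv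
  -- Both out-neighbours of `v` are reached from `b` without `v`, hence so is every other vertex.
  have hreach : ∀ y, ReflTransGen H.Adj v y → y = v ∨ ReflTransGen (H.AdjOff {v}) b y := by
    intro y hy
    induction hy with
    | refl => exact .inl rfl
    | @tail y z _ hyz ih =>
      by_cases hz : z = v
      · exact .inl hz
      right
      rcases ih with rfl | ih
      · rcases huniq z hyz with rfl | rfl
        · exact hba
        · exact .refl
      · exact ih.tail ⟨hyz, reach_adjOff_notMem ih hbv.1, hz⟩
  -- Another in-neighbour `w` would be a fourth vertex. If `b` reaches `w` without `v` and `a`, the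
  -- cycle is a → b ⇝ w → v → a. Otherwise it is b ⇝ w → v → b, and `a` is reached too, since the
  -- way from `b` to `w` cannot miss it.
  have hin : ∀ w, H.Adj w v → w = a ∨ w = b := by
    intro w hwv
    by_contra! hw
    obtain ⟨hwa, hwb⟩ := hw
    obtain ⟨-, kw, -, hkw, hkwv⟩ := id hwv
    have hbw := (hreach w (reach_adj hH v w)).resolve_left hwv.1
    have hfin : ∀ U, H.Perfect U → v ∈ U → a ∈ U → b ∈ U → w ∈ U → False := by
      intro U hU hv ha hb hwU
      have := big U hU hv ha hb hwU
      simp [hwa, hwb, hwv.1] at this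
    by_cases hα : ReflTransGen (H.AdjOff {v, a}) b w
    · obtain ⟨T, h0, hinj, hroot, j, hj, hj1, hj2⟩ := exists_extension_path (H := H)
        (T := {kw, ka, ab}) (r := H.AdjOff {v, a})
        (injOn_src_triple (by rw [hkw, hka]; exact hwv.1) (by rwa [hkw, habs])
          (by rw [hka, habs]; exact hva.1)) (fun _ _ h => h.arc) (Set.mem_insert _ _)
        (hkw ▸ hα)
      have hjn := reach_adjOff_notMem hj1 (by simp [hbv.1, hab.1.symm])
      have e1 : ReflTransGen (H.Arc T) b w := by
        rcases hj with rfl | rfl | rfl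
        · rwa [hkw] at hj2
        · simp [hka] at hjn
        · simp [habs] at hjn
      have e2 : ReflTransGen (H.Arc T) w v := reach_of_mem (h0 (by simp)) hkw hkwv
      have e3 : ReflTransGen (H.Arc T) v a := reach_of_mem (h0 (by simp)) hka hkaa
      have e4 : ReflTransGen (H.Arc T) a b := reach_of_mem (h0 (by simp)) habs habt
      obtain ⟨U, hU, hUT⟩ := exists_perfect hH hinj a ⟨kw, h0 (by simp)⟩ (by
        intro l hl
        obtain ⟨m, hm, hlm⟩ := hroot l hl
        refine hlm.trans ?_
        rcases hm with rfl | rfl | rfl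
        · rw [hkw]; exact e2.trans e3
        · rwa [hka]
        · rw [habs])
      exact hfin U hU (hUT v (e4.trans (e1.trans e2))) (hUT a .refl) (hUT b e4)
        (hUT w (e4.trans e1))
    · obtain ⟨T, h0, hinj, hroot, j, hj, hj1, hj2⟩ := exists_extension_path (H := H)
        (T := {kw, kb}) (r := H.AdjOff {v})
        (injOn_src_pair (by rw [hkw, hkb]; exact hwv.1)) (fun _ _ h => h.arc)
        (Set.mem_insert _ _) (hkw ▸ hbw)
      have hjn := reach_adjOff_notMem hj1 hbv.1
      have e1 : ReflTransGen (H.Arc T) b w := by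
        rcases hj with rfl | rfl
        · rwa [hkw] at hj2
        · exact (hjn hkb).elim
      have e2 : ReflTransGen (H.Arc T) w v := reach_of_mem (h0 (by simp)) hkw hkwv
      have e3 : ReflTransGen (H.Arc T) v b := reach_of_mem (h0 (by simp)) hkb hkbb
      obtain ⟨U, hU, hUT⟩ := exists_perfect hH hinj b ⟨kw, h0 (by simp)⟩ (by
        intro l hl
        obtain ⟨m, hm, hlm⟩ := hroot l hl
        refine hlm.trans ?_
        rcases hm with rfl | rfl
        · rw [hkw]; exact e2.trans e3
        · rwa [hkb])
      refine hfin U hU (hUT v (e1.trans e2)) (hUT a ?_) (hUT b .refl) (hUT w e1)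
      by_contra hna
      have key : ∀ y, ReflTransGen (H.Arc T) b y →
          y = v ∨ ReflTransGen (H.AdjOff {v, a}) b y := by
        intro y hy
        induction hy with
        | refl => exact .inr .refl
        | @tail y z hy hyz ih =>
          by_cases hz : z = v
          · exact .inl hz
          right
          have hza : z ≠ a := by
            rintro rfl
            exact hna (hy.tail hyz)
          by_cases hyz' : y = z
          · exact hyz' ▸ ih.resolve_left (hyz' ▸ hz)
          have hadj : H.Adj y z := ⟨hyz', hyz.mono (Set.subset_univ _)⟩
          rcases ih with rfl | ih
          · rcases huniq z hadj with rfl | rfl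
            · exact (hza rfl).elim
            · exact .refl
          · exact ih.tail ⟨hadj, reach_adjOff_notMem ih (by simp [hbv.1, hab.1.symm]),
              by simp [hz, hza]⟩
      exact hα ((key w e1).resolve_left hwv.1)
  -- A star entering `v` lies on a cycle through `v`: a → v → b ⇝ a if it starts at `a`, and b → v →
  -- a → b if it starts at `b`. The resulting perfect set contains all its sinks.
  have hE : ∀ i, H.Crosses i {v}ᶜ → (H.src i = a ∨ H.src i = b) ∧ H.tgt i ⊆ {a, b, v} := by
    rintro i ⟨h1, t, ht, h2⟩
    have ht' : t = v := by simpa using h2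
    subst ht'
    have hs := hin _ ⟨h1, i, trivial, rfl, ht⟩
    refine ⟨hs, ?_⟩
    rcases hs with hs | hs
    · obtain ⟨T, h0, hinj, hroot, j, hj, hj1, hj2⟩ := exists_extension_path (H := H)
        (T := {i, kb}) (r := H.AdjOff {t})
        (injOn_src_pair (by rw [hs, hkb]; exact hva.1.symm)) (fun _ _ h => h.arc)
        (Set.mem_insert _ _) (hs ▸ hba)
      have hjn := reach_adjOff_notMem hj1 hbv.1
      have e1 : ReflTransGen (H.Arc T) b a := by
        rcases hj with rfl | rfl
        · rwa [hs] at hj2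
        · exact (hjn hkb).elim
      have e2 : ReflTransGen (H.Arc T) a t := reach_of_mem (h0 (by simp)) hs ht
      have e3 : ReflTransGen (H.Arc T) t b := reach_of_mem (h0 (by simp)) hkb hkbb
      obtain ⟨U, hU, hUT⟩ := exists_perfect hH hinj a ⟨i, h0 (by simp)⟩ (by
        intro l hl
        obtain ⟨m, hm, hlm⟩ := hroot l hl
        refine hlm.trans ?_
        rcases hm with rfl | rfl
        · rw [hs]
        · rw [hkb]; exact e3.trans e1)
      exact fun s hs' => big U hU (hUT t e2) (hUT a .refl) (hUT b (e2.trans e3))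
        (hUT s (reach_of_mem (h0 (by simp)) hs hs'))
    · have e2 : ReflTransGen (H.Arc {i, ka, ab}) b t := reach_of_mem (by simp) hs ht
      have e3 : ReflTransGen (H.Arc {i, ka, ab}) t a := reach_of_mem (by simp) hka hkaa
      have e4 : ReflTransGen (H.Arc {i, ka, ab}) a b := reach_of_mem (by simp) habs habt
      obtain ⟨U, hU, hUT⟩ := exists_perfect hH (T := {i, ka, ab})
        (injOn_src_triple (by rw [hs, hka]; exact hvb.1.symm) (by rw [hs, habs]; exact hab.1.symm)
          (by rw [hka, habs]; exact hva.1)) a ⟨i, by simp⟩ (by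
        rintro l (rfl | rfl | rfl)
        · rw [hs]; exact e2.trans e3
        · rwa [hka]
        · rw [habs])
      exact fun s hs' => big U hU (hUT t (e4.trans e2)) (hUT a .refl) (hUT b e4)
        (hUT s (e4.trans (reach_of_mem (by simp) hs hs')))
  have e2 : ReflTransGen (H.Arc {bv, ka, ab}) b v := reach_of_mem (by simp) hbvs hbvt
  have e3 : ReflTransGen (H.Arc {bv, ka, ab}) v a := reach_of_mem (by simp) hka hkaa
  have e4 : ReflTransGen (H.Arc {bv, ka, ab}) a b := reach_of_mem (by simp) habs habt
  obtain ⟨U, hU, hUT⟩ := exists_perfect hH (T := {bv, ka, ab})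
    (injOn_src_triple (by rw [hbvs, hka]; exact hvb.1.symm) (by rw [hbvs, habs]; exact hab.1.symm)
      (by rw [hka, habs]; exact hva.1)) a ⟨bv, by simp⟩ (by
    rintro l (rfl | rfl | rfl)
    · rw [hbvs]; exact e2.trans e3
    · rwa [hka]
    · rw [habs])
  have haU := hUT a .refl
  have hbU := hUT b e4
  have hvU := hUT v (e4.trans e2)
  refine hred (reducible_of_cut hU hvU (fun y hy => ?_) (two_le_ncard hvU haU hva.1) (E := {v}ᶜ)
    ⟨a, hva.1.symm⟩ ⟨v, by simp⟩ ?_ ?_)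
  · rcases huniq y hy with rfl | rfl <;> assumption
  · intro h
    have : a ∈ ({v} : Set V)ᶜ := hva.1.symm
    rw [h] at this
    exact hva.1.symm this
  · intro l hl
    obtain ⟨h1, h3⟩ := hE l hl
    refine ⟨hl.1, ?_, h3.trans ?_⟩
    · rcases h1 with h | h <;> rw [h] <;> assumption
    · rintro y (rfl | rfl | rfl) <;> assumption

/-! ### The ratio 8/5 for star systems -/

theorem independent_singletons [Nontrivial V] : H.Independent (Set.range fun v : V => {v}) := by
  refine ⟨?_, ?_⟩
  · rintro _ ⟨v, rfl⟩
    obtain ⟨w, hw⟩ := exists_ne v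
    exact ⟨⟨v, rfl⟩, ⟨w, hw⟩⟩
  · rintro i _ ⟨v, rfl⟩ _ ⟨w, rfl⟩ ⟨h1, -⟩ ⟨h2, -⟩
    have h1 : H.src i = v := h1
    have h2 : H.src i = w := h2
    rw [← h1, ← h2]

/-- The larger of `𝒮` and the family of singletons bounds both terms of 6(|V| - 1) + 2|𝒮|. -/
theorem exists_connects_independent_ratio [Finite V] [Finite ι] (hH : H.Connects Set.univ) :
    ∃ (R : Set ι) (𝒮 : Set (Set V)), H.Connects R ∧ H.Independent 𝒮 ∧
      5 * R.ncard ≤ 8 * 𝒮.ncard := by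
  obtain ⟨R, 𝒮, hR, h𝒮, hc⟩ :=
    exists_connects_independent (fun _ hH h2 => reducible hH h2) _ H hH rfl
  rcases lt_or_ge (Nat.card V) 2 with h2 | h2
  · exact ⟨R, 𝒮, hR, h𝒮, by omega⟩
  rcases le_total (Nat.card V) 𝒮.ncard with h | h
  · exact ⟨R, 𝒮, hR, h𝒮, by omega⟩
  · have : Nontrivial V := Finite.one_lt_card_iff_nontrivial.1 (by omega)
    refine ⟨R, _, hR, independent_singletons, ?_⟩
    rw [← Set.image_univ, Set.ncard_image_of_injective _ Set.singleton_injective, Set.ncard_univ]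
    omega

end StarSystem

/-! ### Integral primal and dual solutions, and weak duality -/

namespace CutProgram

variable {V ι : Type*} (P : CutProgram V ι)

theorem mem_boundary {S : Finset V} {i : ι} :
    i ∈ P.boundary S ↔ i ∈ P.elements ∧ P.Crosses i S := by
  simp [boundary]

theorem primalValue_indicator {R : Finset ι} (hR : R ⊆ P.elements) :
    P.primalValue (Set.indicator (R : Set ι) fun _ => 1) = R.card := by
  rw [primalValue, Finset.sum_indicator_subset _ hR]
  simp

variable [Fintype V]

theorem mem_cuts {S : Finset V} : S ∈ cuts V ↔ S.Nonempty ∧ S ≠ Finset.univ := by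
  simp [cuts]

theorem mem_crossedCuts {S : Finset V} {i : ι} :
    S ∈ P.crossedCuts i ↔ S ∈ cuts V ∧ i ∈ P.boundary S := by
  simp [crossedCuts]

theorem primalFeasible_indicator {R : Finset ι} (hR : R ⊆ P.elements)
    (h : ∀ S ∈ cuts V, ∃ i ∈ R, P.Crosses i S) :
    P.PrimalFeasible (Set.indicator (R : Set ι) fun _ => 1) := by
  have h0 : ∀ i, (0 : ℝ) ≤ Set.indicator (R : Set ι) (fun _ => 1) i :=
    fun i => Set.indicator_nonneg (fun _ _ => zero_le_one) i
  refine ⟨fun S hS => ?_, fun i _ => h0 i⟩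
  obtain ⟨i, hi, hiS⟩ := h S hS
  refine le_trans ?_ (Finset.single_le_sum (fun j _ => h0 j)
    ((P.mem_boundary).2 ⟨hR hi, hiS⟩))
  rw [Set.indicator_of_mem (Finset.mem_coe.2 hi)]

/-- Each dual constraint has at most one nonzero term. -/
theorem dualFeasible_indicator {𝒮 : Finset (Finset V)}
    (h : ∀ i ∈ P.elements, ∀ S ∈ 𝒮, ∀ T ∈ 𝒮, P.Crosses i S → P.Crosses i T → S = T) :
    P.DualFeasible (Set.indicator (𝒮 : Set (Finset V)) fun _ => 1) := by
  refine ⟨fun i hi => ?_, fun S _ => Set.indicator_nonneg (fun _ _ => zero_le_one) S⟩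
  by_cases hex : ∃ S ∈ P.crossedCuts i, S ∈ 𝒮
  · obtain ⟨S, hS, hS𝒮⟩ := hex
    rw [Finset.sum_eq_single_of_mem S hS, Set.indicator_of_mem (Finset.mem_coe.2 hS𝒮)]
    intro T hT hTS
    refine Set.indicator_of_notMem (fun hT𝒮 => hTS ?_) _
    exact h i hi T hT𝒮 S hS𝒮 ((P.mem_boundary).1 ((P.mem_crossedCuts).1 hT).2).2
      ((P.mem_boundary).1 ((P.mem_crossedCuts).1 hS).2).2
  · push Not at hex
    rw [Finset.sum_eq_zero fun S hS => Set.indicator_of_notMem (hex S hS) _]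
    exact zero_le_one

theorem dualValue_indicator {𝒮 : Finset (Finset V)} (h : 𝒮 ⊆ cuts V) :
    dualValue (Set.indicator (𝒮 : Set (Finset V)) fun _ => 1) = 𝒮.card := by
  rw [dualValue, Finset.sum_indicator_subset _ h]
  simp

theorem weak_duality {x : ι → ℝ} {y : Finset V → ℝ} (hx : P.PrimalFeasible x)
    (hy : P.DualFeasible y) : dualValue y ≤ P.primalValue x := by
  calc dualValue y ≤ ∑ S ∈ cuts V, ∑ i ∈ P.boundary S, y S * x i := by
        refine Finset.sum_le_sum fun S hS => ?_
        rw [← Finset.mul_sum]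
        exact le_mul_of_one_le_right (hy.2 S hS) (hx.1 S hS)
    _ = ∑ i ∈ P.elements, ∑ S ∈ P.crossedCuts i, y S * x i := by
        refine Finset.sum_comm' fun S i => ?_
        rw [mem_crossedCuts, mem_boundary]
        tauto
    _ ≤ P.primalValue x := by
        refine Finset.sum_le_sum fun i hi => ?_
        rw [← Finset.sum_mul]
        exact mul_le_of_le_one_left (hx.2 i hi) (hy.1 i hi)

/-- `R` bounds the integer optimum from above and, by weak duality, `y` bounds the fractional
optimum from below. -/
theorem gap_le {R : Finset ι} (hR : R ⊆ P.elements) {y : Finset V → ℝ}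
    (hRf : P.PrimalFeasible (Set.indicator (R : Set ι) fun _ => 1)) (hy : P.DualFeasible y)
    (hc : (R.card : ℝ) ≤ 8 / 5 * dualValue y) : P.ilpOpt / P.lpOpt ≤ 8 / 5 := by
  refine ENNReal.div_le_of_le_mul ?_
  have h1 : P.ilpOpt ≤ ENNReal.ofReal R.card := by
    refine (iInf₂_le _ ⟨hRf, fun i _ => ?_⟩).trans (by rw [P.primalValue_indicator hR])
    by_cases hi : i ∈ (R : Set ι)
    · exact ⟨1, by simp [Set.indicator_of_mem hi]⟩
    · exact ⟨0, by simp [Set.indicator_of_notMem hi]⟩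
  have h2 : ENNReal.ofReal (dualValue y) ≤ P.lpOpt :=
    le_iInf₂ fun x hx => ENNReal.ofReal_le_ofReal (P.weak_duality hx hy)
  have h3 : ENNReal.ofReal (8 / 5) = 8 / 5 := by
    rw [ENNReal.ofReal_div_of_pos (by norm_num)]
    norm_num
  calc P.ilpOpt ≤ ENNReal.ofReal (8 / 5 * dualValue y) := h1.trans (ENNReal.ofReal_le_ofReal hc)
    _ = 8 / 5 * ENNReal.ofReal (dualValue y) := by
        rw [ENNReal.ofReal_mul (by norm_num), h3]
    _ ≤ 8 / 5 * P.lpOpt := by gcongr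

open Relation in
/-- A cut program whose elements are the stars of a strongly connected star system has an integral
primal solution and an integral dual solution that differ by a factor of at most `8 / 5`. -/
theorem exists_primal_dual (H : StarSystem V {i // i ∈ P.elements}) (hH : H.Connects Set.univ)
    (hcross : ∀ i (S : Finset V), P.Crosses i.1 S ↔ H.Crosses i S) :
    ∃ (R : Finset ι) (y : Finset V → ℝ), R ⊆ P.elements ∧
      H.Connects {i | i.1 ∈ R} ∧ P.PrimalFeasible (Set.indicator (R : Set ι) fun _ => 1) ∧
      P.DualFeasible y ∧ DualIntegral y ∧ (R.card : ℝ) ≤ 8 / 5 * dualValue y := by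
  classical
  obtain ⟨R, 𝒮, hR, h𝒮, hc⟩ := StarSystem.exists_connects_independent_ratio hH
  let R' : Finset ι := R.toFinset.map (Function.Embedding.subtype _)
  let 𝒮' : Finset (Finset V) := Finset.univ.filter fun S => (S : Set V) ∈ 𝒮
  have hmemR : ∀ i : {i // i ∈ P.elements}, i.1 ∈ R' ↔ i ∈ R := by
    intro i
    simp [R']
  have hR' : R' ⊆ P.elements := by
    intro i hi
    simp only [R', Finset.mem_map, Set.mem_toFinset] at hi
    obtain ⟨j, -, rfl⟩ := hi
    exact j.2
  have hRset : {i : {i // i ∈ P.elements} | i.1 ∈ R'} = R := Set.ext hmemR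
  have hmem𝒮 : ∀ S : Finset V, S ∈ 𝒮' ↔ (S : Set V) ∈ 𝒮 := by simp [𝒮']
  have h𝒮' : 𝒮' ⊆ cuts V := by
    intro S hS
    obtain ⟨h1, x, hx⟩ := h𝒮.1 _ ((hmem𝒮 S).1 hS)
    refine mem_cuts.2 ⟨by simpa using h1, ?_⟩
    rintro rfl
    simp at hx
  have hcR : R'.card = R.ncard := by
    rw [Finset.card_map, Set.ncard_eq_toFinset_card']
  have hc𝒮 : 𝒮'.card = 𝒮.ncard := by
    rw [← Set.ncard_coe_finset]
    have : (𝒮' : Set (Finset V)) = (fun S : Finset V => (S : Set V)) ⁻¹' 𝒮 := by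
      ext S
      simp [𝒮']
    rw [this]
    refine Set.ncard_preimage_of_injective_subset_range Finset.coe_injective fun S _ => ?_
    exact ⟨S.toFinset, by simp⟩
  refine ⟨R', Set.indicator (𝒮' : Set (Finset V)) fun _ => 1, hR', hRset ▸ hR,
    P.primalFeasible_indicator hR' ?_, P.dualFeasible_indicator ?_, ?_, ?_⟩
  · intro S hS
    obtain ⟨h1, h2⟩ := mem_cuts.1 hS
    obtain ⟨i, hi, hiS⟩ := StarSystem.exists_crosses hR (S := (S : Set V)) (by simpa using h1)
      (by
        rw [Set.nonempty_compl]
        simpa using h2)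
    exact ⟨i, (hmemR i).2 hi, (hcross i S).2 hiS⟩
  · intro i hi S hS T hT h1 h2
    exact Finset.coe_injective (h𝒮.2 ⟨i, hi⟩ S ((hmem𝒮 S).1 hS) T ((hmem𝒮 T).1 hT)
      ((hcross ⟨i, hi⟩ S).1 h1) ((hcross ⟨i, hi⟩ T).1 h2))
  · intro S _
    by_cases hS : S ∈ (𝒮' : Set (Finset V))
    · exact ⟨1, by simp [Set.indicator_of_mem hS]⟩
    · exact ⟨0, by simp [Set.indicator_of_notMem hS]⟩
  · rw [dualValue_indicator h𝒮', hcR, hc𝒮]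
    have : (5 : ℝ) * R.ncard ≤ 8 * 𝒮.ncard := by exact_mod_cast hc
    linarith

end CutProgram

/-! ### Application to the two problems -/

namespace SSCInstance

variable {V : Type*} (I : SSCInstance V)

/-- The star system of an instance of Star Strong Connectivity. -/
noncomputable def starSystem : StarSystem V {F // F ∈ I.stars} where
  src F := (I.isStar F.1 F.2).2.choose
  tgt F := {t | ∃ e ∈ F.1, e.2 = t}

theorem fst_eq_src {F : {F // F ∈ I.stars}} {e : V × V} (he : e ∈ F.1) :
    e.1 = I.starSystem.src F := (I.isStar F.1 F.2).2.choose_spec e he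

theorem starSystem_arc {F : {F // F ∈ I.stars}} {u v : V} :
    (u, v) ∈ F.1 ↔ I.starSystem.src F = u ∧ v ∈ I.starSystem.tgt F := by
  constructor
  · intro h
    exact ⟨(I.fst_eq_src h).symm, _, h, rfl⟩
  · rintro ⟨rfl, e, he, rfl⟩
    rw [← I.fst_eq_src he]
    exact he

theorem exists_solution [Fintype V] :
    ∃ (R : Finset (Finset (V × V))) (y : Finset V → ℝ),
      I.IsSolution R ∧
      I.program.PrimalFeasible (Set.indicator (R : Set (Finset (V × V))) fun _ => 1) ∧
      I.program.DualFeasible y ∧ DualIntegral y ∧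
      (R.card : ℝ) ≤ 8 / 5 * dualValue y := by
  have hconn : I.starSystem.Connects Set.univ := by
    intro u v
    refine Relation.ReflTransGen.mono ?_ _ _ (I.stronglyConnected u v)
    intro a b hab
    obtain ⟨F, hF, h⟩ := (I.cover a b).1 hab
    exact ⟨⟨F, hF⟩, trivial, I.starSystem_arc.1 h⟩
  have hcross : ∀ i (S : Finset V), I.program.Crosses i.1 S ↔ I.starSystem.Crosses i S := by
    rintro F S
    constructor
    · rintro ⟨e, he, h1, h2⟩
      exact ⟨I.fst_eq_src he ▸ h1, e.2, ⟨e, he, rfl⟩, h2⟩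
    · rintro ⟨h1, _, ⟨e, he, rfl⟩, h2⟩
      exact ⟨e, he, I.fst_eq_src he ▸ h1, h2⟩
  obtain ⟨R, y, hR, hR', h1, h2, h3, h4⟩ := I.program.exists_primal_dual I.starSystem hconn hcross
  refine ⟨R, y, ⟨hR, fun u v => ?_⟩, h1, h2, h3, h4⟩
  refine Relation.ReflTransGen.mono ?_ _ _ (hR' u v)
  rintro a b ⟨F, hF, hab⟩
  exact ⟨F.1, hF, I.starSystem_arc.2 hab⟩

end SSCInstance

namespace MSCSInstance

variable {V : Type*} (I : MSCSInstance V)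

/-- The star system of single arcs. -/
def starSystem : StarSystem V {e // e ∈ I.arcs} where
  src e := e.1.1
  tgt e := {e.1.2}

theorem exists_solution [Fintype V] :
    ∃ (T : Finset (V × V)) (y : Finset V → ℝ),
      I.IsSolution T ∧
      I.program.PrimalFeasible (Set.indicator (T : Set (V × V)) fun _ => 1) ∧
      I.program.DualFeasible y ∧ DualIntegral y ∧
      (T.card : ℝ) ≤ 8 / 5 * dualValue y := by
  have hconn : I.starSystem.Connects Set.univ := by
    intro u v
    refine Relation.ReflTransGen.mono ?_ _ _ (I.stronglyConnected u v)
    intro a b hab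
    exact ⟨⟨(a, b), hab⟩, trivial, rfl, rfl⟩
  have hcross : ∀ i (S : Finset V), I.program.Crosses i.1 S ↔ I.starSystem.Crosses i S := by
    rintro e S
    simp [program, starSystem, StarSystem.Crosses]
  obtain ⟨T, y, hT, hT', h1, h2, h3, h4⟩ := I.program.exists_primal_dual I.starSystem hconn hcross
  refine ⟨T, y, ⟨hT, fun u v => ?_⟩, h1, h2, h3, h4⟩
  refine Relation.ReflTransGen.mono ?_ _ _ (hT' u v)
  rintro a b ⟨⟨⟨c, d⟩, he⟩, heT, rfl, rfl⟩
  exact heT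

end MSCSInstance

theorem mainTheorem4 :
    sscIntegralityGap ≤ 8 / 5 ∧
    mscsIntegralityGap ≤ 8 / 5 ∧
    (∀ (V : Type*) [Fintype V] (I : SSCInstance V),
      ∃ (R : Finset (Finset (V × V))) (y : Finset V → ℝ),
        I.IsSolution R ∧
        I.program.PrimalFeasible (Set.indicator (R : Set (Finset (V × V))) fun _ => 1) ∧
        I.program.DualFeasible y ∧ DualIntegral y ∧
        (R.card : ℝ) ≤ 8 / 5 * dualValue y) ∧
    (∀ (V : Type*) [Fintype V] (I : MSCSInstance V),
      ∃ (T : Finset (V × V)) (y : Finset V → ℝ),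
        I.IsSolution T ∧
        I.program.PrimalFeasible (Set.indicator (T : Set (V × V)) fun _ => 1) ∧
        I.program.DualFeasible y ∧ DualIntegral y ∧
        (T.card : ℝ) ≤ 8 / 5 * dualValue y) := by
  refine ⟨iSup_le fun n => iSup₂_le fun _ I => ?_, iSup_le fun n => iSup₂_le fun _ I => ?_,
    fun V _ I => I.exists_solution, fun V _ I => I.exists_solution⟩
  · obtain ⟨R, y, hR, h1, h2, -, h3⟩ := I.exists_solution
    exact I.program.gap_le hR.1 h1 h2 h3
  · obtain ⟨T, y, hT, h1, h2, -, h3⟩ := I.exists_solution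
    exact I.program.gap_le hT.1 h1 h2 h3
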